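/- The $\lambda$-terms (of the pure untyped $\lambda$-calculus, possibly with free variables, taken modulo $\alpha$-equivalence) have the depth $\operatorname{depth}(x)=0$ for variables $x$, $\operatorname{depth}(P\,Q)=1+\max\{\operatorname{depth}(P),\operatorname{depth}(Q)\}$, $\operatorname{depth}(\lambda x.P)=1+\operatorname{depth}(P)$; that is, the length of a longest path from the root to a leaf in the syntax tree. A leftmost-outermost $\beta$-reduction step $P\to_{\mathrm{lo}}P'$ contracts the leftmost-outermost $\beta$-redex of $P$. **Theorem (Linear depth increase in leftmost-outermost $\beta$-rewrite sequences).** Let $M$ be a $\lambda$-term. Then for every finite or infinite leftmost-outermost $\beta$-rewrite sequence $M=L_0\to_{\mathrm{lo}}L_1\to_{\mathrm{lo}}\cdots\to_{\mathrm{lo}}L_k\,(\to_{\mathrm{lo}}L_{k+1}\to_{\mathrm{lo}}\cdots)$ from $M$ with length $l\in\mathbb{N}\cup\{\infty\}$ the following holds: 1. $\operatorname{depth}(L_{n+1})\le\operatorname{depth}(L_n)+\operatorname{depth}(M)$ for all $n\in\mathbb{N}$ with $n+1\le l$; that is, the depth increase in each step is uniformly bounded by $\operatorname{depth}(M)$.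 2. $\operatorname{depth}(L_n)\le\operatorname{depth}(M)+n\cdot\operatorname{depth}(M)=(n+1)\cdot\operatorname{depth}(M)$ for all $n\in\mathbb{N}$ with $n\le l$, and hence $\operatorname{depth}(L_n)-\operatorname{depth}(M)\in O(n)$, where $n$ ranges over all $n\in\mathbb{N}$ with $n\le l$. -/

import Mathlib

/-- Terms of the (pure, untyped) λ-calculus modulo α-equivalence, in de Bruijn notation.
An index that points beyond all enclosing abstractions stands for a free variable. -/
inductive LTerm : Type where
  | var (i : ℕ) : LTerm
  | app (P Q : LTerm) : LTerm
  | abs (P : LTerm) : LTerm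

namespace LTerm

/-- The depth of a term: the length of a longest path from the root to a leaf in its
syntax tree. -/
def depth : LTerm → ℕ
  | var _ => 0
  | app P Q => 1 + max (depth P) (depth Q)
  | abs P => 1 + depth P

/-- `shift c P` increments every index of `P` that is free relative to `c` enclosing
abstractions. -/
def shift : ℕ → LTerm → LTerm
  | c, var i => if i < c then var i else var (i + 1)
  | c, app P Q => app (shift c P) (shift c Q)
  | c, abs P => abs (shift (c + 1) P)

/-- `subst k N P` is the capture-avoiding substitution of `N` for the variable with index `k`
in `P`, where the abstraction that binds this variable is removed (so that all larger free
indices are decremented). -/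
def subst : ℕ → LTerm → LTerm → LTerm
  | k, N, var i => if i < k then var i else if i = k then N else var (i - 1)
  | k, N, app P Q => app (subst k N P) (subst k N Q)
  | k, N, abs P => abs (subst (k + 1) (shift 0 N) P)

/-- One-step β-reduction: the compatible closure of `(λx.P) Q → P[x := Q]`. -/
inductive Beta : LTerm → LTerm → Prop where
  | beta (P Q : LTerm) : Beta (app (abs P) Q) (subst 0 Q P)
  | appL {P P' : LTerm} (Q : LTerm) (h : Beta P P') : Beta (app P Q) (app P' Q)
  | appR (P : LTerm) {Q Q' : LTerm} (h : Beta Q Q') : Beta (app P Q) (app P Q')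
  | abs {P P' : LTerm} (h : Beta P P') : Beta (abs P) (abs P')

/-- β-normal forms. -/
def IsNormal (P : LTerm) : Prop := ∀ P' : LTerm, ¬ Beta P P'

/-- `P` is an abstraction. -/
def IsAbs (P : LTerm) : Prop := ∃ P' : LTerm, P = LTerm.abs P'

/-- One-step leftmost-outermost β-reduction. A β-redex is contracted such that no other
β-redex contains it or lies to the left of it: an application that is itself a β-redex is
contracted at its root; in an application that is not a β-redex, the step takes place in the
function part, and in the argument only if the function part is a β-normal form. -/
inductive LoBeta : LTerm → LTerm → Prop where
  | beta (P Q : LTerm) : LoBeta (app (abs P) Q) (subst 0 Q P)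
  | appL {P P' : LTerm} (Q : LTerm) (hP : ¬ IsAbs P) (h : LoBeta P P') :
      LoBeta (app P Q) (app P' Q)
  | appR {P Q Q' : LTerm} (hP : ¬ IsAbs P) (hn : IsNormal P) (h : LoBeta Q Q') :
      LoBeta (app P Q) (app P Q')
  | abs {P P' : LTerm} (h : LoBeta P P') : LoBeta (abs P) (abs P')

/-- `L` is a leftmost-outermost rewrite sequence `M = L 0 → L 1 → ⋯` from `M` of finite or
infinite length `l`, where only the entries `L n` with `n ≤ l` belong to the sequence. -/
def IsLoRewriteSeq (M : LTerm) (l : ℕ∞) (L : ℕ → LTerm) : Prop :=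
  L 0 = M ∧ ∀ n : ℕ, ((n + 1 : ℕ) : ℕ∞) ≤ l → LoBeta (L n) (L (n + 1))

end LTerm

/-!
Contracting `(λx.P) Q` pushes `Q` down to the occurrences of `x` in `P`, so it increases the depth
of the whole term by at most the depth, within `P`, of the deepest occurrence of `x`. It therefore
suffices to show that every abstraction that is *contracted* in a leftmost-outermost rewrite
sequence from `M` has its variable at depth at most `depth M` in its body.

Call a term `d`-bounded (`BoundedBinders d`) if all its abstractions have this property with the
bound `d`. Capture-avoiding substitution never moves a variable that stays bound, so `d`-bounded
terms are closed under substitution (`BoundedBinders.subst`), and hence under contraction of a redex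
that is not below an abstraction. A step below an abstraction may destroy boundedness, but a
leftmost-outermost step takes place there only if everything above the abstraction is again an
abstraction, or an application with a variable in head position. Such an abstraction never becomes
part of a redex.
This is captured by the predicate `Admissible d`: a frame of abstractions and of applications
with a variable in head position, filled with `d`-bounded terms. It is invariant under
leftmost-outermost steps (`LoBeta.admissible`), each of which increases the depth of an admissible
term by at most `d` (`LoBeta.depth_le`). Since `M` itself is `depth M`-bounded, the theorem follows.
-/

namespace LTerm

/-! ### Depth of variable occurrences -/

/-- `OccursAt k n P`: the variable with index `k` (as seen from the root of `P`) has an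
occurrence at depth `n` in `P`. -/
def OccursAt : ℕ → ℕ → LTerm → Prop
  | k, n, var i => i = k ∧ n = 0
  | k, n, app P Q => ∃ m, n = m + 1 ∧ (OccursAt k m P ∨ OccursAt k m Q)
  | k, n, abs P => ∃ m, n = m + 1 ∧ OccursAt (k + 1) m P

theorem OccursAt.le_depth {P : LTerm} {k n : ℕ} (h : OccursAt k n P) : n ≤ P.depth := by
  induction P generalizing k n with
  | var i => exact h.2.le
  | app P Q ihP ihQ =>
    obtain ⟨m, rfl, h | h⟩ := h
    · have := ihP h
      simp only [depth]; omega
    · have := ihQ h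
      simp only [depth]; omega
  | abs P ih =>
    obtain ⟨m, rfl, h⟩ := h
    have := ih h
    simp only [depth]; omega

theorem depth_shift (c : ℕ) (P : LTerm) : (shift c P).depth = P.depth := by
  induction P generalizing c with
  | var i => simp only [shift]; split <;> rfl
  | app P Q ihP ihQ => simp only [shift, depth, ihP, ihQ]
  | abs P ih => simp only [shift, depth, ih]

theorem OccursAt.of_shift {P : LTerm} {c j n : ℕ} (h : OccursAt j n (shift c P)) :
    (j < c ∧ OccursAt j n P) ∨ (c < j ∧ OccursAt (j - 1) n P) := by
  induction P generalizing c j n with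
  | var i =>
    simp only [shift] at h
    split at h <;> simp only [OccursAt] at h ⊢ <;> omega
  | app P Q ihP ihQ =>
    obtain ⟨m, rfl, h | h⟩ := h
    · exact (ihP h).imp (fun h => ⟨h.1, m, rfl, .inl h.2⟩) (fun h => ⟨h.1, m, rfl, .inl h.2⟩)
    · exact (ihQ h).imp (fun h => ⟨h.1, m, rfl, .inr h.2⟩) (fun h => ⟨h.1, m, rfl, .inr h.2⟩)
  | abs P ih =>
    obtain ⟨m, rfl, h⟩ := h
    rcases ih h with ⟨h₁, h₂⟩ | ⟨h₁, h₂⟩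
    · exact .inl ⟨by omega, m, rfl, h₂⟩
    · refine .inr ⟨by omega, m, rfl, ?_⟩
      rwa [show j - 1 + 1 = j + 1 - 1 by omega]

/-- Substitution for the variable `k` neither creates nor moves occurrences of a variable `j`
that is bound further inside than `k` and does not occur in the substituted term. -/
theorem OccursAt.of_subst {P N : LTerm} {j k n : ℕ} (hjk : j < k)
    (hN : ∀ m, ¬ OccursAt j m N) (h : OccursAt j n (subst k N P)) : OccursAt j n P := by
  induction P generalizing N j k n with
  | var i =>
    simp only [subst] at h
    split at h
    · exact h
    · split at h
      · exact absurd h (hN n)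
      · have := h.1
        omega
  | app P Q ihP ihQ =>
    obtain ⟨m, rfl, h⟩ := h
    exact ⟨m, rfl, h.imp (ihP hjk hN) (ihQ hjk hN)⟩
  | abs P ih =>
    obtain ⟨m, rfl, h⟩ := h
    refine ⟨m, rfl, ih (by omega) (fun p hp => ?_) h⟩
    rcases hp.of_shift with hp | hp
    · exact absurd hp.1 (by omega)
    · exact hN p hp.2

theorem depth_subst_le {P N : LTerm} {k e : ℕ}
    (h : ∀ n, OccursAt k n P → n + N.depth ≤ e) :
    (subst k N P).depth ≤ max P.depth e := by
  induction P generalizing N k e with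
  | var i =>
    simp only [subst]
    split
    · simp [depth]
    · split
      · next hi => simpa [depth] using h 0 ⟨hi, rfl⟩
      · simp [depth]
  | app P Q ihP ihQ =>
    have hP := @ihP N k (e - 1) fun n hn => by
      have := h (n + 1) ⟨n, rfl, .inl hn⟩
      omega
    have hQ := @ihQ N k (e - 1) fun n hn => by
      have := h (n + 1) ⟨n, rfl, .inr hn⟩
      omega
    simp only [subst, depth]; omega
  | abs P ih =>
    have hP := @ih (shift 0 N) (k + 1) (e - 1) fun n hn => by
      have := h (n + 1) ⟨n, rfl, hn⟩
      rw [depth_shift]; omega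
    simp only [subst, depth]; omega

/-! ### Terms with bounded binders -/

/-- `BoundedBinders d P`: for every subterm `λx.R` of `P`, all occurrences of `x` in `R` are
at depth at most `d`, measured from the root of `R`. -/
def BoundedBinders (d : ℕ) : LTerm → Prop
  | var _ => True
  | app P Q => BoundedBinders d P ∧ BoundedBinders d Q
  | abs P => (∀ n, OccursAt 0 n P → n ≤ d) ∧ BoundedBinders d P

variable {d : ℕ}

theorem boundedBinders_of_depth_le {P : LTerm} (h : P.depth ≤ d) : BoundedBinders d P := by
  induction P with
  | var i => trivial
  | app P Q ihP ihQ =>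
    simp only [depth] at h
    exact ⟨ihP (by omega), ihQ (by omega)⟩
  | abs P ih =>
    simp only [depth] at h
    have hP : P.depth ≤ d := by omega
    exact ⟨fun n hn => hn.le_depth.trans hP, ih hP⟩

theorem BoundedBinders.shift {P : LTerm} (h : BoundedBinders d P) (c : ℕ) :
    BoundedBinders d (LTerm.shift c P) := by
  induction P generalizing c with
  | var i => simp only [LTerm.shift]; split <;> trivial
  | app P Q ihP ihQ => exact ⟨ihP h.1 c, ihQ h.2 c⟩
  | abs P ih =>
    refine ⟨fun n hn => ?_, ih h.2 (c + 1)⟩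
    rcases hn.of_shift with hn | hn
    · exact h.1 n hn.2
    · exact absurd hn.1 (by omega)

theorem BoundedBinders.subst {P N : LTerm} (hP : BoundedBinders d P)
    (hN : BoundedBinders d N) (k : ℕ) : BoundedBinders d (LTerm.subst k N P) := by
  induction P generalizing N k with
  | var i =>
    simp only [LTerm.subst]
    split
    · trivial
    · split
      · exact hN
      · trivial
  | app P Q ihP ihQ => exact ⟨ihP hP.1 hN k, ihQ hP.2 hN k⟩
  | abs P ih =>
    refine ⟨fun n hn => hP.1 n (hn.of_subst (by omega) fun m hm => ?_),
      ih hP.2 (hN.shift 0) (k + 1)⟩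
    rcases hm.of_shift with hm | hm <;> exact absurd hm.1 (by omega)

/-! ### Leftmost-outermost steps -/

/-- `P` is a variable applied to finitely many arguments. -/
def Neutral : LTerm → Prop
  | var _ => True
  | app P _ => Neutral P
  | abs _ => False

theorem IsNormal.neutral {P : LTerm} (hn : IsNormal P) (ha : ¬ IsAbs P) : Neutral P := by
  induction P with
  | var i => trivial
  | app P Q ihP _ =>
    refine ihP (fun P' h => hn _ (.appL Q h)) ?_
    rintro ⟨R, rfl⟩
    exact hn _ (.beta R Q)
  | abs P _ => exact absurd ⟨P, rfl⟩ ha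

theorem LoBeta.neutral {P P' : LTerm} (h : LoBeta P P') (hP : Neutral P) : Neutral P' := by
  induction h with
  | beta P Q => exact hP.elim
  | appL Q _ _ ih => exact ih hP
  | appR _ _ _ _ => exact hP
  | abs _ _ => exact hP.elim

/-- A leftmost-outermost step from a term that is not an abstraction is a head step, which does
not take place below an abstraction and so preserves boundedness, or it starts from a neutral
term. -/
theorem LoBeta.boundedBinders_or_neutral {P P' : LTerm} (h : LoBeta P P') (ha : ¬ IsAbs P)
    (hP : BoundedBinders d P) : BoundedBinders d P' ∨ Neutral P := by
  induction h with
  | beta P Q => exact .inl (hP.1.2.subst hP.2 0)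
  | appL Q ha' _ ih => exact (ih ha' hP.1).imp_left fun h => ⟨h, hP.2⟩
  | appR ha' hn _ _ => exact .inr (hn.neutral ha')
  | @abs P _ _ _ => exact absurd ⟨P, rfl⟩ ha

/-- Terms that are built from terms with `d`-bounded binders by abstractions and by applications
of neutral terms. The abstractions of this outer frame may bind variables at any depth: they
cannot become part of a redex by leftmost-outermost steps. -/
inductive Admissible (d : ℕ) : LTerm → Prop where
  | bounded {P : LTerm} (h : BoundedBinders d P) : Admissible d P
  | abs {P : LTerm} (h : Admissible d P) : Admissible d (abs P)
  | app {P Q : LTerm} (hn : Neutral P) (hP : Admissible d P) (hQ : Admissible d Q) :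
      Admissible d (app P Q)

theorem Admissible.of_abs {P : LTerm} (h : Admissible d (LTerm.abs P)) : Admissible d P := by
  cases h with
  | bounded h => exact .bounded h.2
  | abs h => exact h

theorem Admissible.of_app {P Q : LTerm} (h : Admissible d (LTerm.app P Q)) :
    Admissible d P ∧ Admissible d Q := by
  cases h with
  | bounded h => exact ⟨.bounded h.1, .bounded h.2⟩
  | app _ hP hQ => exact ⟨hP, hQ⟩

theorem Admissible.boundedBinders_of_redex {P Q : LTerm}
    (h : Admissible d (LTerm.app (LTerm.abs P) Q)) :
    BoundedBinders d (LTerm.app (LTerm.abs P) Q) := by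
  cases h with
  | bounded h => exact h
  | app hn _ _ => exact hn.elim

theorem LoBeta.admissible {P P' : LTerm} (h : LoBeta P P') (hP : Admissible d P) :
    Admissible d P' := by
  induction h with
  | beta P Q =>
    have hb := hP.boundedBinders_of_redex
    exact .bounded (hb.1.2.subst hb.2 0)
  | appL Q ha h ih =>
    have hPQ := hP.of_app
    cases hP with
    | bounded hb =>
      rcases h.boundedBinders_or_neutral ha hb.1 with hb' | hn
      · exact .bounded ⟨hb', hb.2⟩
      · exact .app (h.neutral hn) (ih hPQ.1) hPQ.2
    | app hn _ _ => exact .app (h.neutral hn) (ih hPQ.1) hPQ.2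
  | appR ha hn _ ih =>
    have hPQ := hP.of_app
    exact .app (hn.neutral ha) hPQ.1 (ih hPQ.2)
  | abs _ ih => exact .abs (ih hP.of_abs)

theorem LoBeta.depth_le {P P' : LTerm} (h : LoBeta P P') (hP : Admissible d P) :
    P'.depth ≤ P.depth + d := by
  induction h with
  | beta P Q =>
    have := @depth_subst_le P Q 0 (d + Q.depth) fun n hn =>
      Nat.add_le_add_right (hP.boundedBinders_of_redex.1.1 n hn) _
    simp only [depth]; omega
  | appL Q _ _ ih =>
    have := ih hP.of_app.1
    simp only [depth]; omega
  | appR _ _ _ ih =>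
    have := ih hP.of_app.2
    simp only [depth]; omega
  | abs _ ih =>
    have := ih hP.of_abs
    simp only [depth]; omega

/-! ### Leftmost-outermost rewrite sequences -/

theorem IsLoRewriteSeq.admissible {M : LTerm} {l : ℕ∞} {L : ℕ → LTerm}
    (hL : IsLoRewriteSeq M l L) {n : ℕ} (hn : (n : ℕ∞) ≤ l) : Admissible M.depth (L n) := by
  induction n with
  | zero => exact hL.1 ▸ .bounded (boundedBinders_of_depth_le le_rfl)
  | succ n ih =>
    exact (hL.2 n hn).admissible (ih (le_trans (by exact_mod_cast n.le_succ) hn))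

theorem IsLoRewriteSeq.depth_succ_le {M : LTerm} {l : ℕ∞} {L : ℕ → LTerm}
    (hL : IsLoRewriteSeq M l L) {n : ℕ} (hn : ((n + 1 : ℕ) : ℕ∞) ≤ l) :
    (L (n + 1)).depth ≤ (L n).depth + M.depth :=
  (hL.2 n hn).depth_le (hL.admissible (le_trans (by exact_mod_cast n.le_succ) hn))

theorem IsLoRewriteSeq.depth_le {M : LTerm} {l : ℕ∞} {L : ℕ → LTerm}
    (hL : IsLoRewriteSeq M l L) {n : ℕ} (hn : (n : ℕ∞) ≤ l) :
    (L n).depth ≤ M.depth + n * M.depth := by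
  induction n with
  | zero => simp [hL.1]
  | succ n ih =>
    have h₁ := hL.depth_succ_le hn
    have h₂ := ih (le_trans (by exact_mod_cast n.le_succ) hn)
    rw [Nat.succ_mul]; omega

end LTerm

theorem mainTheorem1 (M : LTerm) (l : ℕ∞) (L : ℕ → LTerm)
    (hL : LTerm.IsLoRewriteSeq M l L) :
    (∀ n : ℕ, ((n + 1 : ℕ) : ℕ∞) ≤ l →
      (L (n + 1)).depth ≤ (L n).depth + M.depth) ∧
    (∀ n : ℕ, (n : ℕ∞) ≤ l →
      (L n).depth ≤ M.depth + n * M.depth ∧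
        M.depth + n * M.depth = (n + 1) * M.depth) ∧
    Asymptotics.IsBigO (Filter.principal {n : ℕ | (n : ℕ∞) ≤ l})
      (fun n : ℕ => ((L n).depth : ℝ) - (M.depth : ℝ)) (fun n : ℕ => (n : ℝ)) := by
  refine ⟨fun n hn => hL.depth_succ_le hn, fun n hn => ⟨hL.depth_le hn, by ring⟩, ?_⟩
  refine Asymptotics.isBigO_principal.2 ⟨M.depth, fun n hn => ?_⟩
  have hub : ((L n).depth : ℝ) ≤ M.depth + n * M.depth := by exact_mod_cast hL.depth_le hn
  -- The depth may also decrease, by at most `depth M`; there is no decrease for `n = 0`.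
  have hlb : (M.depth : ℝ) ≤ (L n).depth + n * M.depth := by
    rcases Nat.eq_zero_or_pos n with rfl | hpos
    · simp [hL.1]
    · exact_mod_cast (Nat.le_mul_of_pos_left _ hpos).trans (Nat.le_add_left _ _)
  rw [Real.norm_eq_abs, Real.norm_natCast, abs_le]
  constructor <;> linarith
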